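/- Let $G$ be a finite simple graph and let $H$ assign to each vertex $x$ a nonempty finite set $H(x)\subseteq\mathbb N$; put $mH(x)=\min H(x)$, $MH(x)=\max H(x)$. Assume that for every vertex $x$ and every $i$ with $mH(x)\le i\le MH(x)$, if $i\notin H(x)$ then $i+1\in H(x)$. For a spanning subgraph $F$ of $G$ let $\mathrm{def}(F;x)=\min_{h\in H(x)}|d_F(x)-h|$ and $\mathrm{def}_H[F]=\sum_{x\in V(G)}\mathrm{def}(F;x)$. A spanning subgraph is called $H$-optimal if it minimizes $\mathrm{def}_H$ among all spanning subgraphs of $G$. Fix an $H$-optimal subgraph $F$ whose edge set $E(F)$ is minimal under inclusion among the $H$-optimal subgraphs, and let $B_0=\{x: d_F(x)\notin H(x)\}$. For a trail $P$, let $F\triangle P$ be the spanning subgraph with edge set $E(F)\triangle E(P)$. A trail $P=v_0v_1\dots v_k$ in $G$ ($k\ge 0$) is a changeable trail if (a) $v_0\in B_0$ and, if $k\ge1$, $v_0v_1\notin E(F)$; (b) $\mathrm{def}(F;x)=\mathrm{def}(F\triangle P;x)=0$ for every $x\in V(P)\setminus\{v_0,v_k\}$; (c) if $v_0=v_i\ne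 v_k$ for some $i$, then $\mathrm{def}(F;v_0)>\mathrm{def}(F\triangle P;v_0)$; (d) for every $l\le k$ the initial trail $v_0v_1\dots v_l$ also satisfies (a)–(c). A changeable trail is odd if $k\ge 1$ and its last edge is not in $F$; otherwise (in particular if $k=0$) it is even. Let $D$ be the set of vertices $v$ such that at least one of the following holds: (i) both an even and an odd changeable trail end at $v$; (ii) $mH(v)<d_F(v)\le MH(v)$ and an even changeable trail ends at $v$; (iii) $mH(v)\le d_F(v)<MH(v)$ and an odd changeable trail ends at $v$. Let $B$ be the set of vertices not in $D$ at which an even changeable trail ends, let $A$ be the set of vertices not in $D$ at which an odd changeable trail ends, and let $C=V(G)\setminus(A\cup B\cup D)$. Then for every $H$-optimal subgraph $R$ of $G$: (1) $d_R(v)\in H(v)$ for all $v\in C$; (2) $d_R(v)\ge MH(v)$ for all $v\in A$; (3) $d_R(v)\le mH(v)$ for all $v\in B$. -/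

import Mathlib

namespace GeneralFactor

noncomputable section

/-- `d_F(x)`, the degree of `x` in the graph `F`. -/
def deg {V : Type*} [Fintype V] (F : SimpleGraph V) (x : V) : ℕ :=
  open Classical in F.degree x

/-- `mH(x)`, the least element of `H(x)`. -/
def mH {V : Type*} (H : V → Set ℕ) (x : V) : ℕ := sInf (H x)

/-- `MH(x)`, the largest element of `H(x)` (for `H(x)` nonempty and bounded). -/
def MH {V : Type*} (H : V → Set ℕ) (x : V) : ℕ := sSup (H x)

/-- Property `(*)`: `H(x)` has no gap of more than one element. -/
def OneGap {V : Type*} (H : V → Set ℕ) : Prop :=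
  ∀ x i, mH H x ≤ i → i ≤ MH H x → i ∉ H x → i + 1 ∈ H x

/-- The distance of `d` from the set `S` of natural numbers. -/
def distSet (d : ℕ) (S : Set ℕ) : ℕ := sInf ((fun h => Nat.dist d h) '' S)

/-- The deficiency `def(F; x)` of the vertex `x` in `F`. -/
def vdef {V : Type*} [Fintype V] (H : V → Set ℕ) (F : SimpleGraph V) (x : V) : ℕ :=
  distSet (deg F x) (H x)

/-- The deficiency `def_H[F]` of the spanning subgraph `F`. -/
def deficiency {V : Type*} [Fintype V] (H : V → Set ℕ) (F : SimpleGraph V) : ℕ :=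
  ∑ x, vdef H F x

/-- The total deficiency `def_H(G)`: the minimum of `def_H[F]` over the spanning subgraphs
`F` of `G`. A spanning subgraph of `G` is a graph `F ≤ G` on the same vertex set. -/
def totalDeficiency {V : Type*} [Fintype V] (G : SimpleGraph V) (H : V → Set ℕ) : ℕ :=
  sInf {k | ∃ F : SimpleGraph V, F ≤ G ∧ deficiency H F = k}

/-- `F` is an `H`-optimal (spanning) subgraph of `G`. -/
def IsOptimal {V : Type*} [Fintype V] (G : SimpleGraph V) (H : V → Set ℕ)
    (F : SimpleGraph V) : Prop :=
  F ≤ G ∧ deficiency H F = totalDeficiency G H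

/-- `F` is an `H`-optimal subgraph of `G` with minimal edge set: the order on graphs with
vertex set `V` is inclusion of edge sets. -/
def IsMinOptimal {V : Type*} [Fintype V] (G : SimpleGraph V) (H : V → Set ℕ)
    (F : SimpleGraph V) : Prop :=
  Minimal (IsOptimal G H) F

/-- `B₀`, the set of vertices that are not feasible in `F`. -/
def B0 {V : Type*} [Fintype V] (H : V → Set ℕ) (F : SimpleGraph V) : Set V :=
  {x | deg F x ∉ H x}

/-- `F △ P`: the graph whose edge set is the symmetric difference of `E(F)` and `E(P)`. -/
def swap {V : Type*} {G : SimpleGraph V} (F : SimpleGraph V) {u w : V} (P : G.Walk u w) :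
    SimpleGraph V :=
  SimpleGraph.fromEdgeSet (symmDiff F.edgeSet {e | e ∈ P.edges})

/-- Conditions (a), (b), (c) for `P = v₀ v₁ … v_k`, where `v₀ = u` and `v_k = w`. -/
structure ChangeCond {V : Type*} [Fintype V] {G : SimpleGraph V} (H : V → Set ℕ)
    (F : SimpleGraph V) {u w : V} (P : G.Walk u w) : Prop where
  start_mem : u ∈ B0 H F
  first_edge : 0 < P.length → s(P.getVert 0, P.getVert 1) ∉ F.edgeSet
  inner : ∀ x ∈ P.support, x ≠ u → x ≠ w → vdef H F x = 0 ∧ vdef H (swap F P) x = 0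
  revisit : ∀ i ≤ P.length, u = P.getVert i → P.getVert i ≠ w →
    vdef H (swap F P) u < vdef H F u

/-- Changeable trails with respect to `F`: `P` is a trail of `G` that satisfies (a)-(c),
and so do all its initial sub-trails `v₀ v₁ … v_l`. -/
def IsChangeable {V : Type*} [Fintype V] {G : SimpleGraph V} (H : V → Set ℕ)
    (F : SimpleGraph V) {u w : V} (P : G.Walk u w) : Prop :=
  P.IsTrail ∧ ChangeCond H F P ∧ ∀ l ≤ P.length, ChangeCond H F (P.take l)

/-- The trail `P` is odd: it has a last edge, and this edge is not in `F`. -/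
def IsOdd {V : Type*} {G : SimpleGraph V} (F : SimpleGraph V) {u w : V}
    (P : G.Walk u w) : Prop :=
  0 < P.length ∧ s(P.penultimate, w) ∉ F.edgeSet

/-- Some odd changeable trail ends at `v`. -/
def OddTo {V : Type*} [Fintype V] (G : SimpleGraph V) (H : V → Set ℕ) (F : SimpleGraph V)
    (v : V) : Prop :=
  ∃ (u : V) (P : G.Walk u v), IsChangeable H F P ∧ IsOdd F P

/-- Some even changeable trail ends at `v`; trails of length zero are even. -/
def EvenTo {V : Type*} [Fintype V] (G : SimpleGraph V) (H : V → Set ℕ) (F : SimpleGraph V)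
    (v : V) : Prop :=
  ∃ (u : V) (P : G.Walk u v), IsChangeable H F P ∧ ¬ IsOdd F P

/-- The set `D`: vertices of type (i), (ii) or (iii). -/
def setD {V : Type*} [Fintype V] (G : SimpleGraph V) (H : V → Set ℕ) (F : SimpleGraph V) :
    Set V :=
  {v | (EvenTo G H F v ∧ OddTo G H F v) ∨
    (mH H v < deg F v ∧ deg F v ≤ MH H v ∧ EvenTo G H F v) ∨
    (mH H v ≤ deg F v ∧ deg F v < MH H v ∧ OddTo G H F v)}

/-- The set `B`. -/
def setB {V : Type*} [Fintype V] (G : SimpleGraph V) (H : V → Set ℕ) (F : SimpleGraph V) :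
    Set V :=
  {v | EvenTo G H F v} \ setD G H F

/-- The set `A`. -/
def setA {V : Type*} [Fintype V] (G : SimpleGraph V) (H : V → Set ℕ) (F : SimpleGraph V) :
    Set V :=
  {v | OddTo G H F v} \ setD G H F

/-- The set `C`: all remaining vertices. -/
def setC {V : Type*} [Fintype V] (G : SimpleGraph V) (H : V → Set ℕ) (F : SimpleGraph V) :
    Set V :=
  (setA G H F ∪ setB G H F ∪ setD G H F)ᶜ

end

end GeneralFactor

/-! The engine is `IsMinOptimal.exists_isChangeable`: if an optimal `R` is infeasible at `v`,
comparing `deg R v` with `deg F v` yields a changeable trail to `v`, odd when `R` is above `F` and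
even when below, under mild side conditions. The induction is on the size of `E(F) △ E(R)`. Some
edge `vy` of this difference improves `v` when toggled in `R`. By optimality, `y` then worsens by
exactly one (`IsOptimal.toggle`), so the new graph is optimal, infeasible at `y` and closer to `F`.
The trail obtained for `y` uses only remaining difference edges, so `yv` can be appended to it,
sometimes after cutting the trail at its first visit to `y`. The one-gap condition and
`IsMinOptimal.deg_lt_mH` supply the conditions for changeability.

At `v ∈ C` no changeable trail ends, so `R` is feasible there. For `v ∈ A`, `deg F v` is the
maximum; for `v ∈ B`, it is at most the minimum. A violating `R` that is infeasible at `v` gives a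
trail of the forbidden parity. One that is feasible at `v` is first moved edge by edge towards an
optimal graph infeasible at `v` (`IsOptimal.exists_infeasible_adjacent`) until `v` becomes
infeasible on the same wrong side. -/

namespace GeneralFactor

/-! ### Distance from an integer to a set of degrees. -/

section Distance

variable {S : Set ℕ} {d h : ℕ}

theorem distSet_le (hh : h ∈ S) : distSet d S ≤ Nat.dist d h :=
  Nat.sInf_le ⟨h, hh, rfl⟩

theorem exists_distSet_eq (hS : S.Nonempty) (d : ℕ) : ∃ h ∈ S, Nat.dist d h = distSet d S := by
  obtain ⟨h, hh, he⟩ := Nat.sInf_mem (hS.image fun h => Nat.dist d h)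
  exact ⟨h, hh, he⟩

theorem distSet_eq_zero_iff (hS : S.Nonempty) : distSet d S = 0 ↔ d ∈ S := by
  constructor
  · intro h0
    obtain ⟨h, hh, he⟩ := exists_distSet_eq hS d
    rw [h0] at he
    rwa [Nat.eq_of_dist_eq_zero he]
  · intro hd
    have := distSet_le (d := d) hd
    rwa [Nat.dist_self, Nat.le_zero] at this

theorem distSet_succ_le (hS : S.Nonempty) : distSet (d + 1) S ≤ distSet d S + 1 := by
  obtain ⟨h, hh, he⟩ := exists_distSet_eq hS d
  have := distSet_le (d := d + 1) hh
  simp only [Nat.dist] at *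
  omega

theorem distSet_le_succ (hS : S.Nonempty) : distSet d S ≤ distSet (d + 1) S + 1 := by
  obtain ⟨h, hh, he⟩ := exists_distSet_eq hS (d + 1)
  have := distSet_le (d := d) hh
  simp only [Nat.dist] at *
  omega

theorem distSet_of_le_sInf (hS : S.Nonempty) (hd : d ≤ sInf S) : distSet d S = sInf S - d := by
  obtain ⟨h, hh, he⟩ := exists_distSet_eq hS d
  have h1 := distSet_le (d := d) (Nat.sInf_mem hS)
  have h2 := Nat.sInf_le hh
  simp only [Nat.dist] at *
  omega

theorem distSet_of_sSup_le (hS : S.Nonempty) (hb : BddAbove S) (hd : sSup S ≤ d) :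
    distSet d S = d - sSup S := by
  obtain ⟨h, hh, he⟩ := exists_distSet_eq hS d
  have h1 := distSet_le (d := d) (Nat.sSup_mem hS hb)
  have h2 := le_csSup hb hh
  simp only [Nat.dist] at *
  omega

end Distance

/-! ### Consequences of the one-gap condition. -/

section Feasible

variable {V : Type*} {H : V → Set ℕ} {x : V} {d : ℕ}

theorem mH_mem (hne : (H x).Nonempty) : mH H x ∈ H x := Nat.sInf_mem hne

theorem mH_le (h : d ∈ H x) : mH H x ≤ d := Nat.sInf_le h

theorem le_MH (hb : BddAbove (H x)) (h : d ∈ H x) : d ≤ MH H x := le_csSup hb h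

/-- Below the maximum, one step up from an infeasible degree reduces the distance. -/
theorem distSet_up (hne : (H x).Nonempty) (hgap : OneGap H) (hd : d ∉ H x) (hM : d < MH H x) :
    distSet (d + 1) (H x) + 1 = distSet d (H x) := by
  rcases lt_or_ge d (mH H x) with hm | hm
  · rw [distSet_of_le_sInf hne (show d ≤ sInf (H x) from hm.le),
      distSet_of_le_sInf hne (show d + 1 ≤ sInf (H x) from hm)]
    change d < sInf (H x) at hm
    omega
  · have h1 := (distSet_eq_zero_iff hne).2 (hgap x d hm hM.le hd)
    have h2 := distSet_le_succ (d := d) hne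
    have h3 := mt (distSet_eq_zero_iff hne).1 hd
    omega

/-- Above the minimum, one step down from an infeasible degree reduces the distance. -/
theorem distSet_down (hne : (H x).Nonempty) (hb : BddAbove (H x)) (hgap : OneGap H)
    (hd : d + 1 ∉ H x) (hm : mH H x ≤ d) :
    distSet d (H x) + 1 = distSet (d + 1) (H x) := by
  rcases le_or_gt (MH H x) d with hM | hM
  · rw [distSet_of_sSup_le hne hb (show sSup (H x) ≤ d from hM),
      distSet_of_sSup_le hne hb (show sSup (H x) ≤ d + 1 from hM.trans d.le_succ)]
    change sSup (H x) ≤ d at hM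
    omega
  · have h0 : d ∈ H x := by
      by_contra h
      exact hd (hgap x d hm hM.le h)
    have h1 := (distSet_eq_zero_iff hne).2 h0
    have h2 := distSet_succ_le (d := d) hne
    have h3 := mt (distSet_eq_zero_iff hne).1 hd
    omega

/-- Below the minimum the distance falls as the degree grows. This locates a degree from the fact
that adding an edge was harmful; the next lemma does the same at the maximum. -/
theorem mH_le_of_distSet_lt (hne : (H x).Nonempty)
    (h : distSet d (H x) < distSet (d + 1) (H x)) : mH H x ≤ d := by
  by_contra! hm
  rw [distSet_of_le_sInf hne (show d ≤ sInf (H x) from hm.le),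
      distSet_of_le_sInf hne (show d + 1 ≤ sInf (H x) from hm)] at h
  omega

theorem lt_MH_of_distSet_lt (hne : (H x).Nonempty) (hb : BddAbove (H x))
    (h : distSet (d + 1) (H x) < distSet d (H x)) : d < MH H x := by
  by_contra! hM
  rw [distSet_of_sSup_le hne hb (show sSup (H x) ≤ d from hM),
      distSet_of_sSup_le hne hb (show sSup (H x) ≤ d + 1 from hM.trans d.le_succ)] at h
  omega

end Feasible

/-! ### Toggling an edge, swapping along a trail, and degrees. -/

section Toggle

variable {V : Type*}

/-- The graph obtained from `F` by adding the edge `xy` if it is missing and removing it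
otherwise. -/
def toggle (F : SimpleGraph V) (x y : V) : SimpleGraph V :=
  SimpleGraph.fromEdgeSet (symmDiff F.edgeSet {s(x, y)})

theorem edgeSet_toggle (F : SimpleGraph V) {x y : V} (hxy : x ≠ y) :
    (toggle F x y).edgeSet = symmDiff F.edgeSet {s(x, y)} := by
  rw [toggle, SimpleGraph.edgeSet_fromEdgeSet, sdiff_eq_left, Set.disjoint_left]
  rintro e (⟨he, -⟩ | ⟨he, -⟩) hd
  · exact F.not_isDiag_of_mem_edgeSet he hd
  · rw [Set.mem_singleton_iff.1 he] at hd
    exact hxy hd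

theorem toggle_comm (F : SimpleGraph V) (x y : V) : toggle F x y = toggle F y x := by
  rw [toggle, toggle, Sym2.eq_swap]

theorem toggle_adj_of_ne (F : SimpleGraph V) {x y a b : V} (hxy : x ≠ y)
    (h : s(a, b) ≠ s(x, y)) : (toggle F x y).Adj a b ↔ F.Adj a b := by
  rw [← SimpleGraph.mem_edgeSet, ← SimpleGraph.mem_edgeSet, edgeSet_toggle F hxy,
    Set.mem_symmDiff, Set.mem_singleton_iff]
  tauto

theorem toggle_adj_self (F : SimpleGraph V) {x y : V} (hxy : x ≠ y) :
    (toggle F x y).Adj x y ↔ ¬ F.Adj x y := by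
  rw [← SimpleGraph.mem_edgeSet, ← SimpleGraph.mem_edgeSet, edgeSet_toggle F hxy,
    Set.mem_symmDiff, Set.mem_singleton_iff]
  tauto

theorem toggle_le {G F : SimpleGraph V} {x y : V} (hF : F ≤ G) (h : G.Adj x y) :
    toggle F x y ≤ G := by
  rw [← SimpleGraph.edgeSet_subset_edgeSet, edgeSet_toggle F h.ne]
  rintro e (⟨he, -⟩ | ⟨he, -⟩)
  · exact SimpleGraph.edgeSet_subset_edgeSet.2 hF he
  · rw [Set.mem_singleton_iff.1 he]
    exact h

theorem edgeSet_swap {G : SimpleGraph V} (F : SimpleGraph V) {u w : V} (P : G.Walk u w) :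
    (swap F P).edgeSet = symmDiff F.edgeSet {e | e ∈ P.edges} := by
  rw [swap, SimpleGraph.edgeSet_fromEdgeSet, sdiff_eq_left, Set.disjoint_left]
  rintro e (⟨he, -⟩ | ⟨he, -⟩) hd
  · exact F.not_isDiag_of_mem_edgeSet he hd
  · exact G.not_isDiag_of_mem_edgeSet (P.edges_subset_edgeSet he) hd

theorem swap_le {G F : SimpleGraph V} (hF : F ≤ G) {u w : V} (P : G.Walk u w) :
    swap F P ≤ G := by
  rw [← SimpleGraph.edgeSet_subset_edgeSet, edgeSet_swap]
  rintro e (⟨he, -⟩ | ⟨he, -⟩)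
  · exact SimpleGraph.edgeSet_subset_edgeSet.2 hF he
  · exact P.edges_subset_edgeSet he

theorem swap_nil {G : SimpleGraph V} (F : SimpleGraph V) (u : V) :
    swap F (SimpleGraph.Walk.nil : G.Walk u u) = F := by
  simp [← SimpleGraph.edgeSet_inj, edgeSet_swap, symmDiff]

theorem swap_concat {G : SimpleGraph V} (F : SimpleGraph V) {u y v : V} (P : G.Walk u y)
    (h : G.Adj y v) (he : s(y, v) ∉ P.edges) :
    swap F (P.concat h) = toggle (swap F P) y v := by
  rw [← SimpleGraph.edgeSet_inj, edgeSet_toggle _ h.ne, edgeSet_swap, edgeSet_swap,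
    symmDiff_assoc]
  congr 1
  ext e
  simp only [SimpleGraph.Walk.edges_concat, List.concat_eq_append, List.mem_append,
    List.mem_singleton, Set.mem_ofPred_eq, Set.mem_symmDiff, Set.mem_singleton_iff]
  constructor
  · rintro (h1 | h1)
    · exact Or.inl ⟨h1, fun h2 => he (h2 ▸ h1)⟩
    · exact Or.inr ⟨h1, fun h2 => he (h1 ▸ h2)⟩
  · tauto

theorem swap_adj_of_notMem {G : SimpleGraph V} (F : SimpleGraph V) {u w a b : V}
    (P : G.Walk u w) (h : s(a, b) ∉ P.edges) : (swap F P).Adj a b ↔ F.Adj a b := by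
  rw [← SimpleGraph.mem_edgeSet, ← SimpleGraph.mem_edgeSet, edgeSet_swap, Set.mem_symmDiff,
    Set.mem_ofPred_eq]
  tauto

/-- This serves twice: the difference shrinks, which drives the inductions, and trails in the new
difference avoid the toggled edge. -/
theorem edgeSet_symmDiff_toggle (F R : SimpleGraph V) {x y : V} (hxy : x ≠ y)
    (h : s(x, y) ∈ symmDiff F.edgeSet R.edgeSet) :
    symmDiff F.edgeSet (toggle R x y).edgeSet = symmDiff F.edgeSet R.edgeSet \ {s(x, y)} := by
  rw [edgeSet_toggle R hxy, ← symmDiff_assoc, symmDiff_comm, Set.symmDiff_def]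
  have : ({s(x, y)} : Set (Sym2 V)) \ symmDiff F.edgeSet R.edgeSet = ∅ := by
    rw [Set.sdiff_eq_empty]
    simpa using h
  rw [this, Set.empty_union]

variable [Fintype V]

theorem deg_eq_ncard (F : SimpleGraph V) (x : V) : deg F x = {y | F.Adj x y}.ncard := by
  classical
  rw [deg, ← SimpleGraph.card_neighborSet_eq_degree, ← Nat.card_eq_fintype_card,
    Nat.card_coe_set_eq]
  rfl

theorem deg_congr {F F' : SimpleGraph V} {x : V} (h : ∀ y, F.Adj x y ↔ F'.Adj x y) :
    deg F x = deg F' x := by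
  simp only [deg_eq_ncard, h]

theorem deg_toggle_of_ne (F : SimpleGraph V) {x y z : V} (hxy : x ≠ y) (hx : z ≠ x)
    (hy : z ≠ y) : deg (toggle F x y) z = deg F z := by
  refine deg_congr fun w => toggle_adj_of_ne F hxy ?_
  rw [ne_eq, Sym2.eq_iff]
  tauto

theorem deg_toggle_of_not_adj (F : SimpleGraph V) {x y : V} (hxy : x ≠ y) (h : ¬ F.Adj x y) :
    deg (toggle F x y) x = deg F x + 1 := by
  have : {z | (toggle F x y).Adj x z} = insert y {z | F.Adj x z} := by
    ext z
    rcases eq_or_ne z y with rfl | hz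
    · simp [toggle_adj_self F hxy, h]
    · have : s(x, z) ≠ s(x, y) := fun h => hz (Sym2.congr_right.1 h)
      simp [toggle_adj_of_ne F hxy this, hz]
  rw [deg_eq_ncard, deg_eq_ncard, this, Set.ncard_insert_of_notMem]
  exact h

theorem deg_toggle_of_adj (F : SimpleGraph V) {x y : V} (h : F.Adj x y) :
    deg (toggle F x y) x + 1 = deg F x := by
  have h0 := h.ne
  have : {z | F.Adj x z} = insert y {z | (toggle F x y).Adj x z} := by
    ext z
    rcases eq_or_ne z y with rfl | hz
    · simp [h]
    · have : s(x, z) ≠ s(x, y) := fun h => hz (Sym2.congr_right.1 h)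
      simp [toggle_adj_of_ne F h0 this, hz]
  rw [deg_eq_ncard, deg_eq_ncard, this, Set.ncard_insert_of_notMem]
  simp [toggle_adj_self F h0, h]

theorem exists_adj_of_deg_lt {F R : SimpleGraph V} {x : V} (h : deg F x < deg R x) :
    ∃ y, R.Adj x y ∧ ¬ F.Adj x y := by
  by_contra! hc
  rw [deg_eq_ncard, deg_eq_ncard] at h
  exact h.not_ge (Set.ncard_le_ncard (fun y hy => hc y hy) (Set.toFinite _))

theorem deg_swap_of_notMem_support {G : SimpleGraph V} (F : SimpleGraph V) {u w x : V}
    (P : G.Walk u w) (hx : x ∉ P.support) : deg (swap F P) x = deg F x :=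
  deg_congr fun _ => swap_adj_of_notMem F P fun h => hx (P.fst_mem_support_of_mem_edges h)

theorem ncard_symmDiff_toggle (F R : SimpleGraph V) {x y : V} (hxy : x ≠ y)
    (h : s(x, y) ∈ symmDiff F.edgeSet R.edgeSet) :
    (symmDiff F.edgeSet (toggle R x y).edgeSet).ncard <
      (symmDiff F.edgeSet R.edgeSet).ncard := by
  rw [edgeSet_symmDiff_toggle F R hxy h]
  exact Set.ncard_sdiff_singleton_lt_of_mem h (Set.toFinite _)

end Toggle

/-! ### Moving between optimal subgraphs. -/

section Optimal

variable {V : Type*} [Fintype V] {G : SimpleGraph V} {H : V → Set ℕ}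

theorem IsOptimal.deficiency_le {R R' : SimpleGraph V} (hR : IsOptimal G H R) (hR' : R' ≤ G) :
    deficiency H R ≤ deficiency H R' := by
  rw [hR.2]
  exact Nat.sInf_le ⟨R', hR', rfl⟩

theorem IsOptimal.of_deficiency_le {R R' : SimpleGraph V} (hR : IsOptimal G H R)
    (hR' : R' ≤ G) (h : deficiency H R' ≤ deficiency H R) : IsOptimal G H R' :=
  ⟨hR', (h.trans_eq hR.2).antisymm (hR.2 ▸ hR.deficiency_le hR')⟩

/-- Only two vertices can worsen: the ends of a toggled edge, or the ends of a trail. The additive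
form avoids natural subtraction. -/
theorem deficiency_add_le {R R' : SimpleGraph V} {a b : V} (hab : a ≠ b)
    (h : ∀ x, x ≠ a → x ≠ b → vdef H R' x ≤ vdef H R x) :
    deficiency H R' + (vdef H R a + vdef H R b) ≤
      deficiency H R + (vdef H R' a + vdef H R' b) := by
  classical
  have hb : b ∈ Finset.univ.erase a := Finset.mem_erase.2 ⟨hab.symm, Finset.mem_univ b⟩
  have key : ∑ x ∈ (Finset.univ.erase a).erase b, vdef H R' x ≤
      ∑ x ∈ (Finset.univ.erase a).erase b, vdef H R x := by
    refine Finset.sum_le_sum fun x hx => h x ?_ ?_ <;> simp_all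
  simp only [deficiency, ← Finset.add_sum_erase _ _ (Finset.mem_univ a),
    ← Finset.add_sum_erase (Finset.univ.erase a) _ hb]
  omega

theorem IsOptimal.vdef_add_le {R R' : SimpleGraph V} (hR : IsOptimal G H R) (hR' : R' ≤ G)
    {a b : V} (hab : a ≠ b) (h : ∀ x, x ≠ a → x ≠ b → vdef H R' x ≤ vdef H R x) :
    vdef H R a + vdef H R b ≤ vdef H R' a + vdef H R' b := by
  have h1 := deficiency_add_le hab h
  have h2 := hR.deficiency_le hR'
  omega

theorem IsOptimal.of_vdef_add_le {R R' : SimpleGraph V} (hR : IsOptimal G H R) (hR' : R' ≤ G)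
    {a b : V} (hab : a ≠ b) (h : ∀ x, x ≠ a → x ≠ b → vdef H R' x ≤ vdef H R x)
    (h' : vdef H R' a + vdef H R' b ≤ vdef H R a + vdef H R b) : IsOptimal G H R' := by
  refine hR.of_deficiency_le hR' ?_
  have h1 := deficiency_add_le hab h
  omega

theorem vdef_eq_zero_iff (hne : ∀ x, (H x).Nonempty) {R : SimpleGraph V} {x : V} :
    vdef H R x = 0 ↔ deg R x ∈ H x :=
  distSet_eq_zero_iff (hne x)

theorem vdef_congr {R R' : SimpleGraph V} {x : V} (h : deg R x = deg R' x) :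
    vdef H R x = vdef H R' x := by
  rw [vdef, vdef, h]

theorem deg_toggle_eq_or (F : SimpleGraph V) {x y : V} (hxy : x ≠ y) :
    deg (toggle F x y) x = deg F x + 1 ∨ deg (toggle F x y) x + 1 = deg F x := by
  by_cases h : F.Adj x y
  · exact Or.inr (deg_toggle_of_adj F h)
  · exact Or.inl (deg_toggle_of_not_adj F hxy h)

theorem vdef_toggle_le (hne : ∀ x, (H x).Nonempty) (F : SimpleGraph V) {x y : V}
    (hxy : x ≠ y) : vdef H (toggle F x y) y ≤ vdef H F y + 1 := by
  rw [toggle_comm, vdef, vdef]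
  rcases deg_toggle_eq_or F hxy.symm with h | h
  · rw [h]
    exact distSet_succ_le (hne y)
  · rw [← h]
    exact distSet_le_succ (hne y)

/-- If toggling an edge of an optimal subgraph improves one end, then it worsens the other
end by the same amount, and the result is optimal again. -/
theorem IsOptimal.toggle (hne : ∀ x, (H x).Nonempty) {R : SimpleGraph V}
    (hR : IsOptimal G H R) {x y : V} (hxy : G.Adj x y)
    (h : vdef H (toggle R x y) x + 1 = vdef H R x) :
    IsOptimal G H (GeneralFactor.toggle R x y) ∧
      vdef H (GeneralFactor.toggle R x y) y = vdef H R y + 1 := by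
  have h1 := vdef_toggle_le hne R hxy.ne
  have h2 : ∀ z, z ≠ x → z ≠ y →
      vdef H (GeneralFactor.toggle R x y) z ≤ vdef H R z := fun z hx hy =>
    (vdef_congr (deg_toggle_of_ne R hxy.ne hx hy)).le
  have h3 := toggle_le hR.1 hxy
  -- Optimality makes `y` lose at least what `x` gains; `h1` bounds the loss by one.
  have h4 := hR.vdef_add_le h3 hxy.ne h2
  exact ⟨hR.of_vdef_add_le h3 hxy.ne h2 (by omega), by omega⟩

/-- An optimal subgraph `R` has at every vertex that is better in another subgraph `F` of the
host graph an edge of the symmetric difference whose toggling improves the vertex. -/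
theorem exists_toggle_of_vdef_lt (hne : ∀ x, (H x).Nonempty) (hbdd : ∀ x, BddAbove (H x))
    (hgap : OneGap H) {F R : SimpleGraph V} {x : V} (h : vdef H F x < vdef H R x) :
    ∃ y, x ≠ y ∧ s(x, y) ∈ symmDiff F.edgeSet R.edgeSet ∧
      vdef H (toggle R x y) x + 1 = vdef H R x := by
  have hx : deg R x ∉ H x := by
    rw [← vdef_eq_zero_iff hne]
    omega
  rcases lt_trichotomy (deg R x) (deg F x) with hd | hd | hd
  · obtain ⟨y, h1, h2⟩ := exists_adj_of_deg_lt hd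
    refine ⟨y, h1.ne, Or.inl ⟨h1, h2⟩, ?_⟩
    rw [vdef, deg_toggle_of_not_adj R h1.ne h2]
    refine distSet_up (hne x) hgap hx ?_
    -- If `R` already reached the maximum at `x`, the larger degree in `F` would be worse still. The
    -- other case is symmetric at the minimum.
    by_contra! hM
    have e1 := distSet_of_sSup_le (hne x) (hbdd x) hM
    have e2 := distSet_of_sSup_le (hne x) (hbdd x) (hM.trans hd.le)
    rw [vdef, vdef] at h
    omega
  · rw [vdef_congr hd] at h
    exact absurd h (lt_irrefl _)
  · obtain ⟨y, h1, h2⟩ := exists_adj_of_deg_lt hd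
    refine ⟨y, h1.ne, Or.inr ⟨h1, h2⟩, ?_⟩
    have hd' := deg_toggle_of_adj R h1
    rw [vdef, vdef, ← hd']
    rw [← hd'] at hx
    refine distSet_down (hne x) (hbdd x) hgap hx ?_
    by_contra! hm
    have e1 := distSet_of_le_sInf (hne x) (show deg R x ≤ sInf (H x) by
      change _ < sInf (H x) at hm; omega)
    have e2 := distSet_of_le_sInf (hne x) (show deg F x ≤ sInf (H x) by
      change _ < sInf (H x) at hm; omega)
    rw [vdef, vdef] at h
    omega

/-- If a vertex `v` is feasible in the optimal subgraph `R` but not in the optimal subgraph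
`F`, then some optimal subgraph has at `v` an infeasible degree adjacent to that of `R`. -/
theorem IsOptimal.exists_infeasible_adjacent (hne : ∀ x, (H x).Nonempty)
    (hbdd : ∀ x, BddAbove (H x)) (hgap : OneGap H) {F R : SimpleGraph V} {v : V}
    (hF : IsOptimal G H F) (hR : IsOptimal G H R) (hv : vdef H R v < vdef H F v) :
    ∃ R', IsOptimal G H R' ∧ deg R' v ∉ H v ∧
      (deg R' v = deg R v + 1 ∨ deg R' v + 1 = deg R v) := by
  induction hn : (symmDiff F.edgeSet R.edgeSet).ncard using Nat.strong_induction_on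
    generalizing R with
  | _ n ih =>
  -- Since `R` beats `F` at `v` and `F` is optimal, `F` must beat `R` somewhere else.
  obtain ⟨x, hx⟩ : ∃ x, vdef H F x < vdef H R x := by
    by_contra! hc
    have : deficiency H R < deficiency H F :=
      Finset.sum_lt_sum (fun x _ => hc x) ⟨v, Finset.mem_univ v, hv⟩
    exact this.not_ge (hF.deficiency_le hR.1)
  obtain ⟨y, hxy, he, hd⟩ := exists_toggle_of_vdef_lt hne hbdd hgap hx
  have hG : G.Adj x y := by
    rcases he with ⟨he, -⟩ | ⟨he, -⟩
    · exact hF.1 he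
    · exact hR.1 he
  obtain ⟨hopt, hy⟩ := hR.toggle hne hG hd
  have hxv : v ≠ x := by
    rintro rfl
    omega
  rcases eq_or_ne v y with rfl | hvy
  · refine ⟨_, hopt, ?_, ?_⟩
    · rw [← vdef_eq_zero_iff hne]
      omega
    · rw [toggle_comm]
      exact deg_toggle_eq_or R hxy.symm
  · have hdeg := deg_toggle_of_ne R hxy hxv hvy
    rw [← hdeg]
    refine ih _ ?_ hopt (by rwa [vdef_congr hdeg]) rfl
    rw [← hn]
    exact ncard_symmDiff_toggle F R hxy he

/-- The infeasible vertices of a minimal optimal subgraph lie below their minimum. -/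
theorem IsMinOptimal.deg_lt_mH (hne : ∀ x, (H x).Nonempty)
    (hbdd : ∀ x, BddAbove (H x)) (hgap : OneGap H) {F : SimpleGraph V}
    (hF : IsMinOptimal G H F) {x : V} (hx : deg F x ∉ H x) : deg F x < mH H x := by
  by_contra! hm
  have hm' : mH H x < deg F x := hm.lt_of_ne fun h => hx (h ▸ mH_mem (hne x))
  obtain ⟨y, hy⟩ : ∃ y, F.Adj x y := by
    by_contra! hc
    have : deg F x = 0 := by simp [deg_eq_ncard, hc]
    omega
  have hd := deg_toggle_of_adj F hy
  -- Deleting an edge at `x` preserves optimality, contradicting the minimality of `E(F)`.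
  have hopt : IsOptimal G H (toggle F x y) := by
    refine (hF.prop.toggle hne (hF.prop.1 hy) ?_).1
    rw [vdef, vdef, ← hd]
    rw [← hd] at hx
    exact distSet_down (hne x) (hbdd x) hgap hx (by omega)
  have hle : F ≤ toggle F x y := hF.le_of_le hopt (toggle_le le_rfl hy)
  exact (toggle_adj_self F hy.ne).1 (hle hy) hy

theorem IsMinOptimal.deg_le_MH (hne : ∀ x, (H x).Nonempty)
    (hbdd : ∀ x, BddAbove (H x)) (hgap : OneGap H) {F : SimpleGraph V}
    (hF : IsMinOptimal G H F) (x : V) : deg F x ≤ MH H x := by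
  by_cases hx : deg F x ∈ H x
  · exact le_MH (hbdd x) hx
  · exact (hF.deg_lt_mH hne hbdd hgap hx).le.trans (le_MH (hbdd x) (mH_mem (hne x)))

end Optimal

/-! ### Extending, cutting and swapping changeable trails. -/

section Trails

open SimpleGraph

theorem exists_concat_of_length_pos {V : Type*} {G : SimpleGraph V} {u y : V}
    (P : G.Walk u y) (h0 : 0 < P.length) :
    ∃ (z : V) (Q : G.Walk u z) (h : G.Adj z y), P = Q.concat h := by
  cases P with
  | nil => simp at h0
  | cons h p => exact Walk.exists_cons_eq_concat h p

theorem isOdd_concat {V : Type*} {G F : SimpleGraph V} {u y v : V} {P : G.Walk u y}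
    {h : G.Adj y v} : IsOdd F (P.concat h) ↔ ¬ F.Adj y v := by
  simp [IsOdd, Walk.penultimate_concat]

variable {V : Type*} [Fintype V] {G : SimpleGraph V} {H : V → Set ℕ} {F : SimpleGraph V}

theorem IsChangeable.copy {u w u' w' : V} {P : G.Walk u w} (hP : IsChangeable H F P)
    (hu : u = u') (hw : w = w') : IsChangeable H F (P.copy hu hw) := by
  subst hu hw
  exact hP

theorem ChangeCond.copy {u w u' w' : V} {P : G.Walk u w} (hP : ChangeCond H F P)
    (hu : u = u') (hw : w = w') : ChangeCond H F (P.copy hu hw) := by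
  subst hu hw
  exact hP

theorem isChangeable_take {u w : V} {P : G.Walk u w} (hP : IsChangeable H F P) {l : ℕ}
    (hl : l ≤ P.length) : IsChangeable H F (P.take l) := by
  refine ⟨.of_append_left (q := P.drop l) (by rw [Walk.append_take_drop_eq]; exact hP.1),
    hP.2.2 l hl, fun k hk => ?_⟩
  rw [Walk.take_take]
  exact (hP.2.2 _ (by omega)).copy rfl _

/-- Comparing supports absorbs the endpoint casts caused by `take`, so both the removal of a last
edge and `takeUntil` are covered. -/
theorem IsChangeable.of_prefix {u w w' : V} {P : G.Walk u w} {Q : G.Walk u w'}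
    (hP : IsChangeable H F P) (h : Q.support <+: P.support) : IsChangeable H F Q := by
  have hlen := h.length_le
  rw [Walk.length_support, Walk.length_support] at hlen
  have hs : (P.take Q.length).support = Q.support := by
    rw [Walk.support_take, ← Walk.length_support, ← List.prefix_iff_eq_take.1 h]
  have hw : P.getVert Q.length = w' := by
    refine (Walk.getLast_support (P.take Q.length)).symm.trans (Eq.trans ?_ Q.getLast_support)
    congr 1
  have : Q = (P.take Q.length).copy rfl hw := by
    refine Walk.ext_support ?_
    rw [Walk.support_copy, hs]
  rw [this]
  exact (isChangeable_take hP (by omega)).copy rfl hw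

theorem IsChangeable.of_concat {u y v : V} {P : G.Walk u y} {h : G.Adj y v}
    (hP : IsChangeable H F (P.concat h)) : IsChangeable H F P :=
  hP.of_prefix (P.support_prefix_support_concat h)

theorem IsChangeable.concat_notMem {u y v : V} {P : G.Walk u y} {h : G.Adj y v}
    (hP : IsChangeable H F (P.concat h)) : s(y, v) ∉ P.edges := by
  have := hP.1.edges_nodup
  rw [Walk.edges_concat, List.concat_eq_append, List.nodup_append] at this
  exact fun h => this.2.2 _ h _ (List.mem_singleton_self _) rfl

theorem isChangeable_nil {u : V} (hu : deg F u ∉ H u) :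
    IsChangeable H F (Walk.nil : G.Walk u u) := by
  have h : ChangeCond H F (Walk.nil : G.Walk u u) :=
    ⟨hu, by simp, by simp, fun i _ _ h => absurd rfl h⟩
  exact ⟨.nil, h, fun l hl => by
    rw [Walk.take_of_length_le (by simp)]
    exact h.copy _ _⟩

/-- Extending a changeable trail by an edge: only the conditions at the former end vertex
have to be checked. -/
theorem IsChangeable.concat (hne : ∀ x, (H x).Nonempty) {u y v : V} {P : G.Walk u y}
    (hP : IsChangeable H F P) (h : G.Adj y v) (he : s(y, v) ∉ P.edges)
    (hstart : P.length = 0 → ¬ F.Adj y v)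
    (hne' : y ≠ u → deg F y ∈ H y ∧ deg (swap F (P.concat h)) y ∈ H y)
    (heq : y = u → vdef H (swap F (P.concat h)) y < vdef H F y) :
    IsChangeable H F (P.concat h) := by
  have hdeg : ∀ x, x ≠ y → x ≠ v →
      vdef H (swap F (P.concat h)) x = vdef H (swap F P) x := fun x hxy hxv => by
    refine vdef_congr ?_
    rw [swap_concat F P h he, deg_toggle_of_ne _ h.ne hxy hxv]
  have hc : ChangeCond H F (P.concat h) := by
    refine ⟨hP.2.1.start_mem, fun _ => ?_, fun x hx hxu hxv => ?_, fun i _ hi hiv => ?_⟩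
    · cases P with
      | nil => exact hstart rfl
      | cons h' p => simpa using hP.2.1.first_edge (by simp)
    · rw [Walk.support_concat, List.mem_append, List.mem_singleton] at hx
      rcases eq_or_ne x y with rfl | hxy
      · rw [vdef_eq_zero_iff hne, vdef_eq_zero_iff hne]
        exact hne' hxu
      · rw [hdeg x hxy hxv]
        exact hP.2.1.inner x (hx.resolve_right hxv) hxu hxy
    · rw [← hi] at hiv
      rcases eq_or_ne y u with rfl | hyu
      · exact heq rfl
      -- The new edge misses `u`, so (c) for `P` at index `0` suffices.
      · rw [hdeg u hyu.symm hiv]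
        exact hP.2.1.revisit 0 (Nat.zero_le _) (by simp) (by simpa using hyu.symm)
  refine ⟨?_, hc, fun l hl => ?_⟩
  · rw [Walk.isTrail_def, Walk.edges_concat, List.concat_eq_append]
    exact hP.1.edges_nodup.append (List.nodup_singleton _) (by simpa using he)
  · rcases hl.eq_or_lt with rfl | hl
    · rw [Walk.take_of_length_le le_rfl]
      exact hc.copy _ _
    · rw [Walk.length_concat, Nat.lt_succ_iff] at hl
      have hw : P.getVert l = (P.concat h).getVert l := by
        rw [Walk.concat_eq_append, Walk.getVert_append]
        split_ifs with h1
        · rfl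
        · simp [hl.antisymm (not_lt.1 h1)]
      have : (P.concat h).take l = (P.take l).copy rfl hw := by
        refine Walk.ext_support ?_
        rw [Walk.support_copy, Walk.support_take, Walk.support_take, Walk.support_concat,
          List.take_append_of_le_length]
        simpa using hl
      rw [this]
      exact (hP.2.2 l hl).copy rfl hw

/-- The initial part of a changeable trail up to the first visit of its end vertex. -/
theorem IsChangeable.exists_first_visit {u y : V} {P : G.Walk u y}
    (hP : IsChangeable H F P) (hyu : y ≠ u) :
    ∃ (z : V) (Q : G.Walk u z) (h : G.Adj z y), IsChangeable H F (Q.concat h) ∧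
      y ∉ Q.support ∧ (Q.concat h).edges ⊆ P.edges := by
  classical
  have hy := P.end_mem_support
  have h1 := P.count_support_takeUntil_eq_one hy
  have h2 := P.support_takeUntil_prefix_support hy
  have h3 := P.edges_takeUntil_subset_edges hy
  generalize P.takeUntil y hy = T at h1 h2 h3
  cases T with
  | nil => exact absurd rfl hyu
  | cons h p =>
    obtain ⟨z, Q, h', e⟩ := Walk.exists_cons_eq_concat h p
    rw [e] at h1 h2 h3
    refine ⟨z, Q, h', hP.of_prefix h2, ?_, h3⟩
    simpa [Walk.support_concat, List.concat_eq_append, List.count_eq_zero] using h1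

theorem deg_swap_concat_of_isOdd {u y v : V} {P : G.Walk u y} {h : G.Adj y v}
    (he : s(y, v) ∉ P.edges) (hF : ¬ F.Adj y v) :
    deg (swap F (P.concat h)) v = deg (swap F P) v + 1 ∧
      deg (swap F (P.concat h)) y = deg (swap F P) y + 1 := by
  rw [swap_concat F P h he]
  have h1 : ¬ (swap F P).Adj y v := by rwa [swap_adj_of_notMem F P he]
  refine ⟨?_, deg_toggle_of_not_adj _ h.ne h1⟩
  rw [toggle_comm]
  exact deg_toggle_of_not_adj _ h.ne' fun h2 => h1 h2.symm

theorem deg_swap_concat_of_not_isOdd {u y v : V} {P : G.Walk u y}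
    {h : G.Adj y v} (he : s(y, v) ∉ P.edges) (hF : F.Adj y v) :
    deg (swap F (P.concat h)) v + 1 = deg (swap F P) v ∧
      deg (swap F (P.concat h)) y + 1 = deg (swap F P) y := by
  rw [swap_concat F P h he]
  have h1 : (swap F P).Adj y v := by rwa [swap_adj_of_notMem F P he]
  refine ⟨?_, deg_toggle_of_adj _ h1⟩
  rw [toggle_comm]
  exact deg_toggle_of_adj _ h1.symm

/-- Condition (c) at `i = 0` already applies to every trail that is not closed. -/
theorem IsChangeable.vdef_start_lt {u y : V} {P : G.Walk u y} (hP : IsChangeable H F P)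
    (hyu : y ≠ u) : vdef H (swap F P) u < vdef H F u :=
  hP.2.1.revisit 0 (Nat.zero_le _) (by simp) (by simpa using hyu.symm)

theorem IsChangeable.vdef_inner_le {u y : V} {P : G.Walk u y} (hP : IsChangeable H F P)
    (x : V) (hxu : x ≠ u) (hxy : x ≠ y) : vdef H (swap F P) x ≤ vdef H F x := by
  by_cases hx : x ∈ P.support
  · rw [(hP.2.1.inner x hx hxu hxy).2]
    exact Nat.zero_le _
  · exact (vdef_congr (deg_swap_of_notMem_support F P hx)).le

/-- A changeable trail worsens its end vertex. -/
theorem IsChangeable.vdef_end_lt (hF : IsOptimal G H F) {u y : V} {P : G.Walk u y}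
    (hP : IsChangeable H F P) (hyu : y ≠ u) : vdef H F y < vdef H (swap F P) y := by
  have h1 := hF.vdef_add_le (swap_le hF.1 P) hyu.symm hP.vdef_inner_le
  have h2 := hP.vdef_start_lt hyu
  omega

/-- The start gains at least one, the inner vertices do not worsen, and the end loses at most one.
-/
theorem IsChangeable.isOptimal_swap (hF : IsOptimal G H F) {u y : V} {P : G.Walk u y}
    (hP : IsChangeable H F P) (hyu : y ≠ u) (h : vdef H (swap F P) y ≤ vdef H F y + 1) :
    IsOptimal G H (swap F P) := by
  have h2 := hP.vdef_start_lt hyu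
  exact hF.of_vdef_add_le (swap_le hF.1 P) hyu.symm hP.vdef_inner_le (by omega)

/-- Before its last edge, a changeable trail leaves its end vertex feasible. -/
theorem IsChangeable.deg_swap_mem (hne : ∀ x, (H x).Nonempty) {u z y : V} {P : G.Walk u z}
    {h : G.Adj z y} (hP : IsChangeable H F (P.concat h)) (hyu : y ≠ u)
    (hy : deg F y ∈ H y) : deg (swap F P) y ∈ H y := by
  by_cases hs : y ∈ P.support
  · rw [← vdef_eq_zero_iff hne]
    exact (hP.of_concat.2.1.inner y hs hyu h.ne').2
  · rwa [deg_swap_of_notMem_support F P hs]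

/-- An infeasible vertex starts a changeable trail along any edge outside `F`. -/
theorem isChangeable_single (hne : ∀ x, (H x).Nonempty) (hgap : OneGap H)
    (hbdd : ∀ x, BddAbove (H x)) {y v : V}
    (hy : deg F y ∉ H y) (hm : deg F y < mH H y) (h : G.Adj y v) (hF : ¬ F.Adj y v) :
    IsChangeable H F ((Walk.nil : G.Walk y y).concat h) := by
  have he : s(y, v) ∉ (Walk.nil : G.Walk y y).edges := by simp
  refine (isChangeable_nil hy).concat hne h he (fun _ => hF)
    (fun h => absurd rfl h) fun _ => ?_
  have h1 := (deg_swap_concat_of_isOdd (F := F) (h := h) he hF).2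
  rw [swap_nil] at h1
  have h2 := distSet_up (hne y) hgap hy (hm.trans_le (le_MH (hbdd y) (mH_mem (hne y))))
  rw [vdef, vdef, h1]
  omega

/-- An even changeable trail extends along an edge outside `F`. -/
theorem IsChangeable.concat_of_not_isOdd (hne : ∀ x, (H x).Nonempty) {u z y v : V}
    {P : G.Walk u z} {h' : G.Adj z y} (hP : IsChangeable H F (P.concat h')) (hyu : y ≠ u)
    (hy : deg F y ∈ H y) (hzy : F.Adj z y) (h : G.Adj y v)
    (he : s(y, v) ∉ (P.concat h').edges) (hF : ¬ F.Adj y v) :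
    IsChangeable H F ((P.concat h').concat h) := by
  refine hP.concat hne h he (by simp) (fun _ => ⟨hy, ?_⟩) fun e => absurd e hyu
  -- The edges entering and leaving `y` cancel, restoring its degree from before the entry.
  have h1 := (deg_swap_concat_of_isOdd (F := F) (h := h) he hF).2
  have h2 := (deg_swap_concat_of_not_isOdd (F := F) (h := h') hP.concat_notMem hzy).1
  rw [h1, h2]
  exact hP.deg_swap_mem hne hyu hy

/-- An odd changeable trail extends along an edge of `F`. -/
theorem IsChangeable.concat_of_isOdd (hne : ∀ x, (H x).Nonempty) {u z y v : V}
    {P : G.Walk u z} {h' : G.Adj z y} (hP : IsChangeable H F (P.concat h'))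
    (hy : y ≠ u → deg F y ∈ H y) (hzy : ¬ F.Adj z y) (h : G.Adj y v)
    (he : s(y, v) ∉ (P.concat h').edges) (hF : F.Adj y v) :
    IsChangeable H F ((P.concat h').concat h) := by
  have h1 := (deg_swap_concat_of_not_isOdd (F := F) (h := h) he hF).2
  have h2 := (deg_swap_concat_of_isOdd (F := F) (h := h') hP.concat_notMem hzy).1
  have h3 : deg (swap F ((P.concat h').concat h)) y = deg (swap F P) y := by omega
  refine hP.concat hne h he (by simp) (fun hyu => ⟨hy hyu, ?_⟩) fun hyu => ?_
  · rw [h3]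
    exact hP.deg_swap_mem hne hyu (hy hyu)
  · subst hyu
    rw [vdef_congr h3]
    exact hP.of_concat.vdef_start_lt h'.ne

/-- A changeable trail to a vertex `y` with `deg F y < MH H y`, stopped at the first visit
of `y`, extends along an edge outside `F`. -/
theorem IsChangeable.exists_concat_of_lt_MH (hne : ∀ x, (H x).Nonempty) (hgap : OneGap H)
    (hopt : IsOptimal G H F) {u y v : V}
    {P : G.Walk u y} (hP : IsChangeable H F P) (hyu : y ≠ u) (hy : deg F y ∈ H y)
    (hM : deg F y < MH H y) (h : G.Adj y v) (he : s(y, v) ∉ P.edges) (hF : ¬ F.Adj y v) :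
    ∃ Q : G.Walk u y, IsChangeable H F (Q.concat h) ∧ Q.edges ⊆ P.edges := by
  obtain ⟨z, Q, h', hQ, hyQ, hsub⟩ := hP.exists_first_visit hyu
  refine ⟨_, ?_, hsub⟩
  have he' := fun h => he (hsub h)
  by_cases hzy : F.Adj z y
  · exact hQ.concat_of_not_isOdd hne hyu hy hzy h he' hF
  · refine hQ.concat hne h he' (by simp) (fun _ => ⟨hy, ?_⟩) fun e => absurd e hyu
    have h1 := (deg_swap_concat_of_isOdd (F := F) (h := h) he' hF).2
    have h2 := (deg_swap_concat_of_isOdd (F := F) (h := h') hQ.concat_notMem hzy).1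
    rw [deg_swap_of_notMem_support F Q hyQ] at h2
    have h3 := hQ.vdef_end_lt hopt hyu
    rw [h1, h2]
    -- Both edges at `y` are added. One addition is infeasible because a trail worsens its end, so
    -- by the gap condition two are feasible.
    refine hgap y _ ((mH_le hy).trans (Nat.le_succ _)) hM ?_
    rw [← h2, ← vdef_eq_zero_iff hne]
    omega

/-- A changeable trail to a vertex `y` with `mH H y < deg F y`, stopped at the first visit
of `y`, extends along an edge of `F`. -/
theorem IsChangeable.exists_concat_of_mH_lt (hne : ∀ x, (H x).Nonempty)
    (hbdd : ∀ x, BddAbove (H x)) (hgap : OneGap H)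
    (hopt : IsOptimal G H F) {u y v : V}
    {P : G.Walk u y} (hP : IsChangeable H F P) (hyu : y ≠ u) (hy : deg F y ∈ H y)
    (hm : mH H y < deg F y) (h : G.Adj y v) (he : s(y, v) ∉ P.edges) (hF : F.Adj y v) :
    ∃ Q : G.Walk u y, IsChangeable H F (Q.concat h) ∧ Q.edges ⊆ P.edges := by
  obtain ⟨z, Q, h', hQ, hyQ, hsub⟩ := hP.exists_first_visit hyu
  refine ⟨_, ?_, hsub⟩
  have he' := fun h => he (hsub h)
  by_cases hzy : F.Adj z y
  · refine hQ.concat hne h he' (by simp) (fun _ => ⟨hy, ?_⟩) fun e => absurd e hyu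
    have h1 := (deg_swap_concat_of_not_isOdd (F := F) (h := h) he' hF).2
    have h2 := (deg_swap_concat_of_not_isOdd (F := F) (h := h') hQ.concat_notMem hzy).1
    rw [deg_swap_of_notMem_support F Q hyQ] at h2
    have h3 := hQ.vdef_end_lt hopt hyu
    have h4 : deg (swap F (Q.concat h')) y ∉ H y := by
      rw [← vdef_eq_zero_iff hne]
      omega
    -- Deleting one edge is infeasible, so `deg F y - 1` is not the minimum and `deg F y - 2` is
    -- still at least the minimum. The gap condition then makes the latter feasible.
    have h5 : mH H y ≠ deg (swap F (Q.concat h')) y := fun e => h4 (e ▸ mH_mem (hne y))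
    have h6 := le_MH (hbdd y) hy
    by_contra hc
    have := hgap y _ (by omega) (by omega) hc
    rw [h1] at this
    exact h4 this
  · exact hQ.concat_of_isOdd hne (fun _ => hy) hzy h he' hF

end Trails

/-! ### Trails from optimal subgraphs, and the three conclusions. -/

section Main

open SimpleGraph

variable {V : Type*} [Fintype V] {G : SimpleGraph V} {H : V → Set ℕ} {F : SimpleGraph V}

/-- A vertex that is infeasible in some optimal subgraph `R` is reached by a changeable trail
inside `E(F) △ E(R)` whose parity is determined by the sign of `deg R v - deg F v`. -/
theorem IsMinOptimal.exists_isChangeable (hne : ∀ x, (H x).Nonempty)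
    (hbdd : ∀ x, BddAbove (H x)) (hgap : OneGap H) (hF : IsMinOptimal G H F)
    {R : SimpleGraph V} (hR : IsOptimal G H R) {v : V} (hv : deg R v ∉ H v) :
    (deg F v < deg R v → mH H v < deg R v → ∃ (u : V) (P : G.Walk u v),
      IsChangeable H F P ∧ IsOdd F P ∧ ∀ e ∈ P.edges, e ∈ symmDiff F.edgeSet R.edgeSet) ∧
    (deg R v < deg F v → deg F v ∈ H v → ∃ (u : V) (P : G.Walk u v),
      IsChangeable H F P ∧ ¬ IsOdd F P ∧ ∀ e ∈ P.edges, e ∈ symmDiff F.edgeSet R.edgeSet) := by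
  induction hn : (symmDiff F.edgeSet R.edgeSet).ncard using Nat.strong_induction_on
    generalizing R v with
  | _ n ih =>
  have hopt := hF.prop
  -- The inductive trail avoids `vy`, so appending this edge repeats none and stays in the larger
  -- difference.
  have hsub : ∀ {y : V} (h : G.Adj y v), s(v, y) ∈ symmDiff F.edgeSet R.edgeSet →
      ∀ {u u' : V} {P : G.Walk u y} {Q : G.Walk u' y}, Q.edges ⊆ P.edges →
      (∀ e ∈ P.edges, e ∈ symmDiff F.edgeSet (toggle R v y).edgeSet) →
      s(y, v) ∉ P.edges ∧
        ∀ e ∈ (Q.concat h).edges, e ∈ symmDiff F.edgeSet R.edgeSet := by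
    intro y h he u u' P Q hQP hP
    rw [edgeSet_symmDiff_toggle F R h.ne' he] at hP
    refine ⟨fun h1 => (hP _ h1).2 Sym2.eq_swap, fun e h1 => ?_⟩
    rw [Walk.edges_concat, List.concat_eq_append, List.mem_append, List.mem_singleton] at h1
    rcases h1 with h1 | rfl
    · exact (hP e (hQP h1)).1
    · rwa [Sym2.eq_swap]
  constructor
  · intro hlt hm
    obtain ⟨y, hRy, hFy⟩ := exists_adj_of_deg_lt hlt
    have hvy := hRy.ne
    have hG : G.Adj y v := (hR.1 hRy).symm
    have hFy' : ¬ F.Adj y v := fun h => hFy h.symm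
    have he : s(v, y) ∈ symmDiff F.edgeSet R.edgeSet := Or.inr ⟨hRy, hFy⟩
    have hdv := deg_toggle_of_adj R hRy
    have hdy := deg_toggle_of_adj R hRy.symm
    rw [toggle_comm] at hdy
    obtain ⟨hR', hvy'⟩ := hR.toggle hne hG.symm (by
      rw [vdef, vdef, ← hdv]
      rw [← hdv] at hv
      exact distSet_down (hne v) (hbdd v) hgap hv (by omega))
    have hy' : deg (toggle R v y) y ∉ H y := by
      rw [← vdef_eq_zero_iff hne]
      omega
    -- Losing an edge hurt `y`, so its new degree lies below the maximum.
    have hM : deg (toggle R v y) y < MH H y := by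
      refine lt_MH_of_distSet_lt (hne y) (hbdd y) ?_
      rw [vdef, vdef, ← hdy] at hvy'
      omega
    have IH := ih _ (hn ▸ ncard_symmDiff_toggle F R hvy he) hR' hy' rfl
    by_cases hy : deg F y ∈ H y
    · have hyu : ∀ {u : V} {P : G.Walk u y}, IsChangeable H F P → y ≠ u := by
        rintro u P hP rfl
        exact hP.2.1.start_mem hy
      rcases lt_trichotomy (deg (toggle R v y) y) (deg F y) with hd | hd | hd
      · obtain ⟨u, P, hP, hodd, hPe⟩ := IH.2 hd hy
        have hyu := hyu hP
        obtain ⟨he', hE⟩ := hsub hG he (List.Subset.refl P.edges) hPe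
        have hpos : 0 < P.length := by
          by_contra! h0
          exact hyu (Walk.eq_of_length_eq_zero (Nat.le_zero.1 h0)).symm
        obtain ⟨z, Q, h', rfl⟩ := exists_concat_of_length_pos P hpos
        rw [isOdd_concat, not_not] at hodd
        exact ⟨u, _, hP.concat_of_not_isOdd hne hyu hy hodd hG he' hFy',
          isOdd_concat.2 hFy', hE⟩
      · exact absurd (hd ▸ hy) hy'
      · obtain ⟨u, P, hP, -, hPe⟩ := IH.1 hd ((mH_le hy).trans_lt hd)
        obtain ⟨he', -⟩ := hsub hG he (List.Subset.refl P.edges) hPe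
        obtain ⟨Q, hQ, hQP⟩ := hP.exists_concat_of_lt_MH hne hgap hopt (hyu hP) hy
          (hd.trans hM) hG he' hFy'
        exact ⟨u, _, hQ, isOdd_concat.2 hFy', (hsub hG he hQP hPe).2⟩
    · refine ⟨y, _, isChangeable_single hne hgap hbdd hy
        (hF.deg_lt_mH hne hbdd hgap hy) hG hFy', isOdd_concat.2 hFy', ?_⟩
      exact (hsub hG he (List.Subset.refl _) (P := (Walk.nil : G.Walk y y)) (by simp)).2
  · intro hlt hv'
    obtain ⟨y, hFy, hRy⟩ := exists_adj_of_deg_lt hlt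
    have hvy := hFy.ne
    have hG : G.Adj y v := (hopt.1 hFy).symm
    have he : s(v, y) ∈ symmDiff F.edgeSet R.edgeSet := Or.inl ⟨hFy, hRy⟩
    have hdv := deg_toggle_of_not_adj R hvy hRy
    have hdy := deg_toggle_of_not_adj R hvy.symm fun h => hRy h.symm
    rw [toggle_comm] at hdy
    obtain ⟨hR', hvy'⟩ := hR.toggle hne hG.symm (by
      rw [vdef, vdef, hdv]
      exact distSet_up (hne v) hgap hv (hlt.trans_le (le_MH (hbdd v) hv')))
    have hy' : deg (toggle R v y) y ∉ H y := by
      rw [← vdef_eq_zero_iff hne]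
      omega
    have hm : mH H y < deg (toggle R v y) y := by
      rw [hdy, Nat.lt_succ_iff]
      refine mH_le_of_distSet_lt (hne y) ?_
      rw [vdef, vdef, hdy] at hvy'
      omega
    have IH := ih _ (hn ▸ ncard_symmDiff_toggle F R hvy he) hR' hy' rfl
    -- An infeasible `y` would lie below the minimum in `F`, whereas its new degree in `R` exceeds
    -- the minimum.
    have hfeas : deg (toggle R v y) y ≤ deg F y → deg F y ∈ H y := fun h => by
      by_contra hy
      have := hF.deg_lt_mH hne hbdd hgap hy
      omega
    have hodd' : ¬ ¬ F.Adj y v := not_not.2 hFy.symm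
    rcases lt_trichotomy (deg (toggle R v y) y) (deg F y) with hd | hd | hd
    · have hy := hfeas hd.le
      obtain ⟨u, P, hP, -, hPe⟩ := IH.2 hd hy
      have hyu : y ≠ u := by
        rintro rfl
        exact hP.2.1.start_mem hy
      obtain ⟨he', -⟩ := hsub hG he (List.Subset.refl P.edges) hPe
      obtain ⟨Q, hQ, hQP⟩ := hP.exists_concat_of_mH_lt hne hbdd hgap hopt hyu hy
          (hm.trans hd) hG he' hFy.symm
      exact ⟨u, _, hQ, fun h => hodd' (isOdd_concat.1 h), (hsub hG he hQP hPe).2⟩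
    · exact absurd (hd ▸ hfeas hd.le) hy'
    · obtain ⟨u, P, hP, hodd, hPe⟩ := IH.1 hd hm
      obtain ⟨he', hE⟩ := hsub hG he (List.Subset.refl P.edges) hPe
      obtain ⟨z, Q, h', rfl⟩ := exists_concat_of_length_pos P hodd.1
      rw [isOdd_concat] at hodd
      refine ⟨u, _, hP.concat_of_isOdd hne (fun hyu => ?_) hodd hG he' hFy.symm,
        fun h => hodd' (isOdd_concat.1 h), hE⟩
      by_contra hy
      -- If `y ≠ u` were infeasible in `F`, it could not be an inner vertex of `Q`. The last edge
      -- would then raise its degree by one from below the minimum and improve it, but a trail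
      -- worsens its end.
      have hyQ : y ∉ Q.support := fun hs => hy <| by
        rw [← vdef_eq_zero_iff hne]
        exact (hP.of_concat.2.1.inner y hs hyu h'.ne').1
      have h1 := (deg_swap_concat_of_isOdd (F := F) (h := h')
        hP.concat_notMem hodd).1
      rw [deg_swap_of_notMem_support F Q hyQ] at h1
      have h2 := hP.vdef_end_lt hopt hyu
      have h3 := distSet_up (hne y) hgap hy
        ((hF.deg_lt_mH hne hbdd hgap hy).trans_le (le_MH (hbdd y) (mH_mem (hne y))))
      rw [vdef, vdef, h1] at h2
      omega

theorem evenTo_of_infeasible {v : V} (hv : deg F v ∉ H v) : EvenTo G H F v :=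
  ⟨v, _, isChangeable_nil hv, fun h => absurd h.1 (by simp)⟩

theorem IsMinOptimal.mem_of_mem_setC (hne : ∀ x, (H x).Nonempty)
    (hbdd : ∀ x, BddAbove (H x)) (hgap : OneGap H) (hF : IsMinOptimal G H F)
    {R : SimpleGraph V} (hR : IsOptimal G H R) {v : V} (hv : v ∈ setC G H F) :
    deg R v ∈ H v := by
  by_contra hRv
  have heven : ¬ EvenTo G H F v := fun h => hv <| by
    by_cases hD : v ∈ setD G H F
    · exact Or.inr hD
    · exact Or.inl (Or.inr ⟨h, hD⟩)
  have hodd : ¬ OddTo G H F v := fun h => hv <| by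
    by_cases hD : v ∈ setD G H F
    · exact Or.inr hD
    · exact Or.inl (Or.inl ⟨h, hD⟩)
  have hFv : deg F v ∈ H v := by
    by_contra h
    exact heven (evenTo_of_infeasible h)
  obtain ⟨h1, h2⟩ := hF.exists_isChangeable hne hbdd hgap hR hRv
  rcases lt_trichotomy (deg F v) (deg R v) with hd | hd | hd
  · obtain ⟨u, P, hP, hPo, -⟩ := h1 hd ((mH_le hFv).trans_lt hd)
    exact hodd ⟨u, P, hP, hPo⟩
  · exact hRv (hd ▸ hFv)
  · obtain ⟨u, P, hP, hPo, -⟩ := h2 hd hFv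
    exact heven ⟨u, P, hP, hPo⟩

theorem IsMinOptimal.MH_le_of_mem_setA (hne : ∀ x, (H x).Nonempty)
    (hbdd : ∀ x, BddAbove (H x)) (hgap : OneGap H) (hF : IsMinOptimal G H F)
    {R : SimpleGraph V} (hR : IsOptimal G H R) {v : V} (hv : v ∈ setA G H F) :
    MH H v ≤ deg R v := by
  by_contra! hlt
  obtain ⟨hodd, hD⟩ := hv
  have heven : ¬ EvenTo G H F v := fun h => hD (Or.inl ⟨h, hodd⟩)
  have hFv : deg F v ∈ H v := by
    by_contra h
    exact heven (evenTo_of_infeasible h)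
  have hMF : deg F v = MH H v := by
    by_contra h
    exact hD (Or.inr (Or.inr ⟨mH_le hFv, (le_MH (hbdd v) hFv).lt_of_ne h, hodd⟩))
  obtain ⟨u, P, hP, -⟩ := hodd
  have hvu : v ≠ u := by
    rintro rfl
    exact hP.2.1.start_mem hFv
  obtain ⟨z, Q, h, hQ, hvQ, -⟩ := hP.exists_first_visit hvu
  have hzv : ¬ F.Adj z v := fun hzv => heven ⟨u, _, hQ, fun ho => isOdd_concat.1 ho hzv⟩
  have h1 := (deg_swap_concat_of_isOdd (F := F) (h := h)
    hQ.concat_notMem hzv).1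
  rw [deg_swap_of_notMem_support F Q hvQ] at h1
  have hopt := hQ.isOptimal_swap hF.prop hvu (by
    rw [vdef, vdef, h1]
    exact distSet_succ_le (hne v))
  have hpos := hQ.vdef_end_lt hF.prop hvu
  -- A degree within one of `deg R v` is at most the maximum, and being infeasible it is strictly
  -- below.
  obtain ⟨R', hR', hRv', hlt'⟩ : ∃ R', IsOptimal G H R' ∧ deg R' v ∉ H v ∧
      deg R' v < deg F v := by
    by_cases hRv : deg R v ∈ H v
    · obtain ⟨R', hR', hRv', hd⟩ := hopt.exists_infeasible_adjacent hne hbdd hgap hR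
        (v := v) (by rw [(vdef_eq_zero_iff hne).2 hRv]; omega)
      refine ⟨R', hR', hRv', ?_⟩
      have : deg R' v ≠ deg F v := fun e => hRv' (e ▸ hFv)
      omega
    · exact ⟨R, hR, hRv, hMF ▸ hlt⟩
  obtain ⟨u', P', hP', hPo, -⟩ := (hF.exists_isChangeable hne hbdd hgap hR' hRv').2 hlt' hFv
  exact heven ⟨u', P', hP', hPo⟩

theorem IsMinOptimal.le_mH_of_mem_setB (hne : ∀ x, (H x).Nonempty)
    (hbdd : ∀ x, BddAbove (H x)) (hgap : OneGap H) (hF : IsMinOptimal G H F)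
    {R : SimpleGraph V} (hR : IsOptimal G H R) {v : V} (hv : v ∈ setB G H F) :
    deg R v ≤ mH H v := by
  by_contra! hlt
  obtain ⟨heven, hD⟩ := hv
  have hodd : ¬ OddTo G H F v := fun h => hD (Or.inl ⟨heven, h⟩)
  have hmF : deg F v ≤ mH H v := by
    by_contra! h
    exact hD (Or.inr (Or.inl ⟨h, hF.deg_le_MH hne hbdd hgap v, heven⟩))
  -- `F` itself may be infeasible at `v`; otherwise a swap along an even trail cut at its first
  -- visit to `v` makes `v` infeasible.
  obtain ⟨F₁, hF₁, hpos⟩ : ∃ F₁, IsOptimal G H F₁ ∧ 0 < vdef H F₁ v := by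
    by_cases hFv : deg F v ∈ H v
    · obtain ⟨u, P, hP, -⟩ := heven
      have hvu : v ≠ u := by
        rintro rfl
        exact hP.2.1.start_mem hFv
      obtain ⟨z, Q, h, hQ, hvQ, -⟩ := hP.exists_first_visit hvu
      have hzv : F.Adj z v := by
        by_contra hzv
        exact hodd ⟨u, _, hQ, isOdd_concat.2 hzv⟩
      have h1 := (deg_swap_concat_of_not_isOdd (F := F) (h := h)
        hQ.concat_notMem hzv).1
      rw [deg_swap_of_notMem_support F Q hvQ] at h1
      refine ⟨_, hQ.isOptimal_swap hF.prop hvu ?_,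
        (Nat.zero_le _).trans_lt (hQ.vdef_end_lt hF.prop hvu)⟩
      rw [vdef, vdef, ← h1]
      exact distSet_le_succ (hne v)
    · exact ⟨F, hF.prop, Nat.pos_of_ne_zero (mt (vdef_eq_zero_iff hne).1 hFv)⟩
  obtain ⟨R', hR', hRv', hlt'⟩ : ∃ R', IsOptimal G H R' ∧ deg R' v ∉ H v ∧
      mH H v < deg R' v := by
    by_cases hRv : deg R v ∈ H v
    · obtain ⟨R', hR', hRv', hd⟩ := hF₁.exists_infeasible_adjacent hne hbdd hgap hR
        (v := v) (by rwa [(vdef_eq_zero_iff hne).2 hRv])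
      refine ⟨R', hR', hRv', ?_⟩
      have : deg R' v ≠ mH H v := fun e => hRv' (e ▸ mH_mem (hne v))
      omega
    · exact ⟨R, hR, hRv, hlt⟩
  obtain ⟨u', P', hP', hPo, -⟩ :=
    (hF.exists_isChangeable hne hbdd hgap hR' hRv').1 (hmF.trans_lt hlt') hlt'
  exact hodd ⟨u', P', hP', hPo⟩

end Main
end GeneralFactor

theorem mainTheorem4 {V : Type*} [Fintype V] (G : SimpleGraph V) (H : V → Set ℕ)
    (hne : ∀ x, (H x).Nonempty) (hbdd : ∀ x, BddAbove (H x))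
    (hgap : GeneralFactor.OneGap H)
    (F : SimpleGraph V) (hF : GeneralFactor.IsMinOptimal G H F)
    (R : SimpleGraph V) (hR : GeneralFactor.IsOptimal G H R) :
    (∀ v ∈ GeneralFactor.setC G H F, GeneralFactor.deg R v ∈ H v) ∧
    (∀ v ∈ GeneralFactor.setA G H F, GeneralFactor.MH H v ≤ GeneralFactor.deg R v) ∧
    (∀ v ∈ GeneralFactor.setB G H F, GeneralFactor.deg R v ≤ GeneralFactor.mH H v) :=
  ⟨fun _ hv => hF.mem_of_mem_setC hne hbdd hgap hR hv,
    fun _ hv => hF.MH_le_of_mem_setA hne hbdd hgap hR hv,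
    fun _ hv => hF.le_mH_of_mem_setB hne hbdd hgap hR hv⟩
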